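/- All groups are finite. Let $\sigma$ be a partition of the set of all primes; for a group $X$ let $\sigma(X)$ be the set of those $\sigma_i\in\sigma$ that contain a prime divisor of $|X|$, and call $X$ $\sigma$-primary if $|\sigma(X)|\le 1$. For a set $\pi$ of primes, $X$ is a $D_\pi$-group if it has Hall $\pi$-subgroups, any two of them are conjugate, and every $\pi$-subgroup of $X$ lies in one of them. A group $G$ is a $\sigma$-full group of Sylow type if every subgroup of $G$ is a $D_{\sigma_i}$-group for every $\sigma_i\in\sigma(G)$. A complete Hall $\sigma$-set of $G$ is a set $\mathcal H$ of subgroups of $G$ such that each non-identity member is a Hall $\sigma_i$-subgroup of $G$ for some $\sigma_i\in\sigma$ and $\mathcal H$ contains exactly one Hall $\sigma_i$-subgroup of $G$ for every $\sigma_i\in\sigma(G)$. A subgroup $A\le G$ is $\sigma$-subnormal in $G$ if there is a chain $A=A_0\le A_1\le\cdots\le A_n=G$ such that, for each $i$, either $A_{i-1}\trianglelefteq A_i$ or $A_i/(A_{i-1})_{A_i}$ is $\sigma$-primary, where $(A_{i-1})_{A_i}$ is the core of $A_{i-1}$ in $A_i$. A subgroup $M\le G$ is modular (in the sense of Kurosh)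 if $\langle X,M\cap Z\rangle=\langle X,M\rangle\cap Z$ for all subgroups $X\le Z$ of $G$, and $\langle M,Y\cap Z\rangle=\langle M,Y\rangle\cap Z$ for all subgroups $Y,Z$ of $G$ with $M\le Z$. Given a complete Hall $\sigma$-set $\mathcal H$ of $G$, a subgroup $B$ is $\mathcal H$-permutable if $BD=DB$ for all $D\in\mathcal H$; a subgroup $S$ is $m$-$\mathcal H$-permutable if $S=\langle A,B\rangle$ for some modular subgroup $A$ and some $\mathcal H$-permutable subgroup $B$ of $G$; a subgroup $H$ is weakly $m$-$\mathcal H$-permutable in $G$ if there are a $\sigma$-subnormal subgroup $T$ of $G$ and an $m$-$\mathcal H$-permutable subgroup $S$ of $G$ with $G=HT$ and $H\cap T\le S\le H$. Let $Z_\infty(G)$ denote the hypercentre of $G$ (the terminal member of the upper central series). For a normal subgroup $E$ of $G$, $E\le Z_{\mathfrak U}(G)$ means that $E$ is hypercyclically embedded in $G$: every chief factor of $G$ below $E$ is cyclic. **Proposition.** Let $G$ be a $\sigma$-full group of Sylow type and $\mathcal H=\{H_1,\dots,H_t\}$ a complete Hall $\sigma$-set of $G$ such that every $H_i$ is supersoluble.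 Let $p$ be a prime and let $P$ be a normal $p$-subgroup of $G$ with $P\le H_j$ for some $j$. Suppose that $H$ is weakly $m$-$\mathcal H$-permutable in $G$ for every cyclic subgroup $H$ of $P$ with $H\not\le Z_\infty(G)$ such that either $|H|$ is prime, or $|H|=4$ and $P$ is a non-abelian $2$-group. Then $P\le Z_{\mathfrak U}(G)$. -/

import Mathlib

open scoped Pointwise

namespace SigmaGroup

/-- The set `σ(G)` of those members of the partition `σ` that contain a prime divisor of `|G|`. -/
def sigmaOf (σ : Set (Set Nat.Primes)) (G : Type*) [Group G] : Set (Set Nat.Primes) :=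
  {s | s ∈ σ ∧ ∃ p ∈ s, (p : ℕ) ∣ Nat.card G}

/-- `G` is `σ`-primary: `|σ(G)| ≤ 1`. -/
def IsSigmaPrimary (σ : Set (Set Nat.Primes)) (G : Type*) [Group G] : Prop :=
  (sigmaOf σ G).Subsingleton

/-- `H` is a `π`-subgroup: every prime divisor of `|H|` lies in `π`. -/
def IsPiSubgroup {G : Type*} [Group G] (π : Set Nat.Primes) (H : Subgroup G) : Prop :=
  ∀ p : Nat.Primes, (p : ℕ) ∣ Nat.card H → p ∈ π

/-- `H` is a Hall `π`-subgroup of `G`: a `π`-subgroup such that no prime in `π` divides its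
index. -/
def IsHall {G : Type*} [Group G] (π : Set Nat.Primes) (H : Subgroup G) : Prop :=
  IsPiSubgroup π H ∧ ∀ p : Nat.Primes, (p : ℕ) ∣ H.index → p ∉ π

/-- `G` is a `D_π`-group: Hall `π`-subgroups exist, any two of them are conjugate, and every
`π`-subgroup is contained in one of them. -/
def IsDGroup (π : Set Nat.Primes) (G : Type*) [Group G] : Prop :=
  (∃ H : Subgroup G, IsHall π H) ∧
  (∀ H K : Subgroup G, IsHall π H → IsHall π K →
    ∃ g : G, K = H.map (MulAut.conj g).toMonoidHom) ∧
  (∀ U : Subgroup G, IsPiSubgroup π U → ∃ H : Subgroup G, IsHall π H ∧ U ≤ H)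

/-- `G` is a `σ`-full group of Sylow type: every subgroup of `G` is a `D_s`-group for every
`s ∈ σ(G)`. -/
def IsSigmaFullSylowType (σ : Set (Set Nat.Primes)) (G : Type*) [Group G] : Prop :=
  ∀ E : Subgroup G, ∀ s ∈ sigmaOf σ G, IsDGroup s E

/-- `𝓗` is a complete Hall `σ`-set of `G`: each non-identity member is a Hall `s`-subgroup for
some `s ∈ σ`, and `𝓗` contains exactly one Hall `s`-subgroup for every `s ∈ σ(G)`. -/
def IsCompleteHallSet {G : Type*} [Group G] (σ : Set (Set Nat.Primes))
    (𝓗 : Set (Subgroup G)) : Prop :=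
  (∀ H ∈ 𝓗, H ≠ ⊥ → ∃ s ∈ σ, IsHall s H) ∧
  (∀ s ∈ sigmaOf σ G, ∃! H : Subgroup G, H ∈ 𝓗 ∧ IsHall s H)

/-- `A` is `σ`-subnormal in `G`: there is a chain `A = A₀ ≤ A₁ ≤ ⋯ ≤ Aₙ = G` such that, at each
step, either the smaller term is normal in the larger one or the larger one modulo the core in it
of the smaller one is `σ`-primary. -/
def IsSigmaSubnormal {G : Type*} [Group G] (σ : Set (Set Nat.Primes)) (A : Subgroup G) : Prop :=
  ∃ (n : ℕ) (C : ℕ → Subgroup G), C 0 = A ∧ C n = ⊤ ∧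
    ∀ i < n, C i ≤ C (i + 1) ∧
      (((C i).subgroupOf (C (i + 1))).Normal ∨
        IsSigmaPrimary σ (C (i + 1) ⧸ ((C i).subgroupOf (C (i + 1))).normalCore))

/-- `M` is a modular subgroup of `G` in the sense of Kurosh, that is, a modular element of the
subgroup lattice. -/
def IsModularSubgroup {G : Type*} [Group G] (M : Subgroup G) : Prop :=
  (∀ X Z : Subgroup G, X ≤ Z → X ⊔ (M ⊓ Z) = (X ⊔ M) ⊓ Z) ∧
  (∀ Y Z : Subgroup G, M ≤ Z → M ⊔ (Y ⊓ Z) = (M ⊔ Y) ⊓ Z)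

/-- `H` is `𝓗`-permutable: `HA = AH` for all `A ∈ 𝓗`. -/
def IsHPermutable {G : Type*} [Group G] (𝓗 : Set (Subgroup G)) (H : Subgroup G) : Prop :=
  ∀ A ∈ 𝓗, (H : Set G) * (A : Set G) = (A : Set G) * (H : Set G)

/-- `H` is `m`-`𝓗`-permutable: `H = ⟨A, B⟩` with `A` modular and `B` `𝓗`-permutable. -/
def IsMHPermutable {G : Type*} [Group G] (𝓗 : Set (Subgroup G)) (H : Subgroup G) : Prop :=
  ∃ A B : Subgroup G, IsModularSubgroup A ∧ IsHPermutable 𝓗 B ∧ H = A ⊔ B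

/-- `H` is weakly `m`-`𝓗`-permutable in `G`: there is a `σ`-subnormal subgroup `T` with `G = HT`
and `H ∩ T ≤ S ≤ H` for some `m`-`𝓗`-permutable subgroup `S` of `G`. -/
def IsWeaklyMHPermutable {G : Type*} [Group G] (σ : Set (Set Nat.Primes))
    (𝓗 : Set (Subgroup G)) (H : Subgroup G) : Prop :=
  ∃ T : Subgroup G, IsSigmaSubnormal σ T ∧ (H : Set G) * (T : Set G) = Set.univ ∧
    ∃ S : Subgroup G, IsMHPermutable 𝓗 S ∧ H ⊓ T ≤ S ∧ S ≤ H

/-- The factor `K / L` (formed inside `G / L`) is cyclic; used for `L ≤ K` with `L` normal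
in `G`. -/
def IsCyclicFactor {G : Type*} [Group G] (K L : Subgroup G) [L.Normal] : Prop :=
  IsCyclic (K.map (QuotientGroup.mk' L))

/-- `K / L` is a chief factor of `G`. -/
def IsChiefFactor {G : Type*} [Group G] (K L : Subgroup G) : Prop :=
  K.Normal ∧ L.Normal ∧ L < K ∧
    ∀ M : Subgroup G, M.Normal → L ≤ M → M ≤ K → M = L ∨ M = K

/-- `G` is supersoluble: there is a series `1 = N₀ ≤ N₁ ≤ ⋯ ≤ Nₙ = G` of normal subgroups of `G`
with cyclic factors. -/
def IsSupersoluble (G : Type*) [Group G] : Prop :=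
  ∃ (n : ℕ) (N : ℕ → Subgroup G) (_ : ∀ i, (N i).Normal), N 0 = ⊥ ∧ N n = ⊤ ∧
    ∀ i < n, N i ≤ N (i + 1) ∧ IsCyclicFactor (N (i + 1)) (N i)

/-- `E` is hypercyclically embedded in `G`, written `E ≤ Z_𝔘(G)`: `E` is normal in `G` and every
chief factor of `G` below `E` is cyclic (for `E = 1` there is none). -/
def IsHypercyclicallyEmbedded {G : Type*} [Group G] (E : Subgroup G) : Prop :=
  E.Normal ∧ ∀ (K L : Subgroup G) [L.Normal], IsChiefFactor K L → K ≤ E → IsCyclicFactor K L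

/-- The hypercentre `Z_∞(G)` of a finite group `G`: the union (terminal member) of the upper
central series. -/
def hypercentre (G : Type*) [Group G] : Subgroup G :=
  ⨆ n : ℕ, Subgroup.upperCentralSeries G n

end SigmaGroup

/-! By induction every proper subgroup of `P` normal in `G` is hypercyclically embedded, so only a
top chief factor `P / R` could be noncyclic. If one is, `R` contains all those subgroups
(`isCyclicFactor_of_sup_eq`), and a contradiction arises from two facts.

The elements of `P` are small. `G` acts on a chief `p`-factor as an abelian group of exponent
dividing `p - 1` exactly when the factor is cyclic. Let `Q` be generated by the `p'`-elements of the
corresponding residual of `G`. By coprime action `Q` centralises `R`, while `[P, Q] = P` since `P /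
R` is noncyclic. The three subgroups lemma makes `R` central in `P`, so `P` has class at most two,
and power maps give exponent dividing `p`, or dividing `4` if `p = 2` and `P` is nonabelian
(`IsChiefFactor.pow_eq_one`). Hence the permutability hypothesis covers every nontrivial `⟨x⟩ ≤ P`
outside the hypercentre.

Some `⟨x⟩R` with `x ∈ P \ R` is normal in `G`. Supersolubility of the member `K ≥ P` gives an `x`
with `⟨x⟩R` normalised by `K`. A Hall member `D` of order prime to `p` normalises `⟨x⟩` or
centralises `P / R` (`IsWeaklyMHPermutable.conj_mem`, `commutator_mem_of_mem_hypercentre`). The Hall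
members generate `G`, so `⟨x⟩R` is normal, equals `P`, and `P / R` is cyclic. -/

open scoped commutatorElement

namespace SigmaGroup

/-! ### Cyclic factors and chief factors. -/

section Factors

variable {G : Type*} [Group G]

theorem isCyclicFactor_iff {K L : Subgroup G} [L.Normal] :
    IsCyclicFactor K L ↔ ∃ x ∈ K, K ≤ Subgroup.zpowers x ⊔ L := by
  unfold IsCyclicFactor
  constructor
  · intro h
    obtain ⟨g, hg⟩ := (Subgroup.isCyclic_iff_exists_zpowers_eq_top _).1 h
    obtain ⟨x, hx, rfl⟩ : g ∈ K.map (QuotientGroup.mk' L) := hg ▸ Subgroup.mem_zpowers g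
    refine ⟨x, hx, ?_⟩
    rw [← MonoidHom.map_zpowers] at hg
    have := Subgroup.le_comap_map (QuotientGroup.mk' L) K
    rwa [← hg, Subgroup.comap_map_eq, QuotientGroup.ker_mk'] at this
  · rintro ⟨x, -, hK⟩
    have hc : IsCyclic (Subgroup.zpowers (QuotientGroup.mk' L x)) := inferInstance
    have h := Subgroup.map_mono (f := QuotientGroup.mk' L) hK
    rw [Subgroup.map_sup, QuotientGroup.map_mk'_self, sup_bot_eq, MonoidHom.map_zpowers] at h
    exact isCyclic_of_injective (Subgroup.inclusion h) (Subgroup.inclusion_injective h)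

/-- `V` is a minimal normal subgroup of `G`. -/
structure IsMinimalNormal (V : Subgroup G) : Prop where
  normal : V.Normal
  ne_bot : V ≠ ⊥
  eq_bot_or_eq : ∀ N : Subgroup G, N.Normal → N ≤ V → N = ⊥ ∨ N = V

theorem IsChiefFactor.isMinimalNormal {K L : Subgroup G} [L.Normal] (h : IsChiefFactor K L) :
    IsMinimalNormal (K.map (QuotientGroup.mk' L)) := by
  obtain ⟨hK, -, hLK, hmin⟩ := h
  have hsurj := QuotientGroup.mk'_surjective L
  refine ⟨hK.map _ hsurj, ?_, ?_⟩
  · rw [Ne, Subgroup.map_eq_bot_iff, QuotientGroup.ker_mk']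
    exact hLK.not_ge
  · intro N hN hNV
    have h1 : L ≤ N.comap (QuotientGroup.mk' L) := by
      conv_lhs => rw [← QuotientGroup.ker_mk' L]
      exact MonoidHom.ker_le_comap _ _
    have h2 : N.comap (QuotientGroup.mk' L) ≤ K := by
      have := Subgroup.comap_mono (f := QuotientGroup.mk' L) hNV
      rwa [Subgroup.comap_map_eq, QuotientGroup.ker_mk', sup_eq_left.2 hLK.le] at this
    have h3 := Subgroup.map_comap_eq_self_of_surjective hsurj N
    rcases hmin _ (hN.comap _) h1 h2 with h | h
    · left; rw [← h3, h, QuotientGroup.map_mk'_self]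
    · right; rw [← h3, h]

/-- `P / R` is `G`-isomorphic to `N / (N ∩ R)`, which is therefore a chief factor below `N`. -/
theorem isCyclicFactor_of_sup_eq {N R P : Subgroup G} (hN : N.Normal) [R.Normal]
    (hNR : N ⊔ R = P) (hchief : IsChiefFactor P R) (hemb : IsHypercyclicallyEmbedded N) :
    IsCyclicFactor P R := by
  obtain ⟨hP, -, hRP, hmin⟩ := hchief
  have hlt : N ⊓ R < N := by
    refine lt_of_le_of_ne inf_le_left fun h => hRP.ne ?_
    rw [← hNR, sup_eq_right.2 (inf_eq_left.1 h)]
  have hc : IsChiefFactor N (N ⊓ R) := by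
    refine ⟨hN, inferInstance, hlt, fun M hM hle hMN => ?_⟩
    rcases hmin (M ⊔ R) inferInstance le_sup_right (hNR ▸ sup_le_sup_right hMN R) with h | h
    · exact Or.inl (le_antisymm (le_inf hMN (sup_eq_right.1 h)) hle)
    · refine Or.inr (le_antisymm hMN fun n hn => ?_)
      have : n ∈ M ⊔ R := by rw [h, ← hNR]; exact Subgroup.mem_sup_left hn
      obtain ⟨m, hm, r, hr, rfl⟩ := Subgroup.mem_sup_of_normal_right.1 this
      refine mul_mem hm (hle ⟨?_, hr⟩)
      simpa using mul_mem (inv_mem (hMN hm)) hn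
  obtain ⟨x, hx, hle⟩ := isCyclicFactor_iff.1 (hemb.2 N (N ⊓ R) hc le_rfl)
  refine isCyclicFactor_iff.2 ⟨x, hNR ▸ Subgroup.mem_sup_left hx, ?_⟩
  rw [← hNR]
  exact sup_le (hle.trans (sup_le_sup_left inf_le_right _)) le_sup_right

end Factors

/-! ### Minimal normal `p`-subgroups are elementary abelian. -/

section MinimalNormal

variable {G : Type*} [Group G] [Finite G] {p : ℕ} [Fact p.Prime] {V : Subgroup G}

/-- The centre of a nontrivial `p`-group is nontrivial and characteristic, so by minimality it is
all of `V`. -/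
theorem IsMinimalNormal.le_centralizer (hV : IsMinimalNormal V) (hp : IsPGroup p V) :
    V ≤ Subgroup.centralizer V := by
  have := hV.normal
  have : Nontrivial V := (Subgroup.nontrivial_iff_ne_bot V).2 hV.ne_bot
  have hc : (Subgroup.center V).map V.subtype ≤ V := Subgroup.map_subtype_le _
  rcases hV.eq_bot_or_eq _ inferInstance hc with h | h
  · rw [Subgroup.map_eq_bot_iff_of_injective _ V.subtype_injective] at h
    exact absurd h hp.bot_lt_center.ne'
  · intro x hx
    rw [← h] at hx
    obtain ⟨y, hy, rfl⟩ := hx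
    rw [Subgroup.mem_centralizer_iff]
    intro z hz
    exact congrArg Subtype.val (Subgroup.mem_center_iff.1 hy ⟨z, hz⟩)

theorem IsMinimalNormal.mul_comm (hV : IsMinimalNormal V) (hp : IsPGroup p V) {x y : G}
    (hx : x ∈ V) (hy : y ∈ V) : x * y = y * x :=
  (Subgroup.mem_centralizer_iff.1 (hV.le_centralizer hp hy) x hx)

theorem IsMinimalNormal.pow_eq_one (hV : IsMinimalNormal V) (hp : IsPGroup p V) {x : G}
    (hx : x ∈ V) : x ^ p = 1 := by
  have := hV.normal
  have : Nontrivial V := (Subgroup.nontrivial_iff_ne_bot V).2 hV.ne_bot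
  let W : Subgroup G :=
    { carrier := {x | x ∈ V ∧ x ^ p = 1}
      one_mem' := ⟨one_mem _, one_pow _⟩
      mul_mem' := by
        rintro a b ⟨ha, ha'⟩ ⟨hb, hb'⟩
        refine ⟨mul_mem ha hb, ?_⟩
        rw [Commute.mul_pow (hV.mul_comm hp ha hb), ha', hb', one_mul]
      inv_mem' := by
        rintro a ⟨ha, ha'⟩
        exact ⟨inv_mem ha, by rw [inv_pow, ha', inv_one]⟩ }
  have hWn : W.Normal := ⟨by
    rintro a ⟨ha, ha'⟩ g
    exact ⟨hV.normal.conj_mem a ha g, by rw [conj_pow, ha', mul_one, mul_inv_cancel]⟩⟩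
  -- Cauchy's theorem rules out `W = ⊥`.
  have hW : W = V := by
    refine (hV.eq_bot_or_eq W hWn fun a ha => ha.1).resolve_left fun h => ?_
    obtain ⟨a, ha⟩ := exists_prime_orderOf_dvd_card' (G := V) p
      (hp.card_eq_or_dvd.resolve_left Finite.one_lt_card.ne')
    have h1 : (a : G) ∈ W := ⟨a.2, by
      rw [← Subgroup.coe_pow, ← ha, pow_orderOf_eq_one, Subgroup.coe_one]⟩
    rw [h, Subgroup.mem_bot] at h1
    rw [show a = 1 from Subtype.ext h1, orderOf_one] at ha
    exact (Fact.out : p.Prime).one_lt.ne ha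
  rw [← hW] at hx
  exact hx.2

end MinimalNormal

/-! ### Eigenvalues over the prime field. -/

-- Such an `f` is a root of `X ^ p - X`, which splits over `ZMod p`; so does its minimal polynomial.
open Polynomial in
theorem exists_hasEigenvalue_of_pow_eq_one {p : ℕ} [Fact p.Prime] {A : Type*} [AddCommGroup A]
    [Module (ZMod p) A] [Finite A] [Nontrivial A] (f : Module.End (ZMod p) A)
    (hf : f ^ (p - 1) = 1) : ∃ c : ZMod p, f.HasEigenvalue c := by
  have hp : p.Prime := Fact.out
  have hdvd : minpoly (ZMod p) f ∣ X ^ p - X := by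
    apply minpoly.dvd
    have : f ^ p = f := by
      rw [← pow_sub_one_mul hp.ne_zero, hf, one_mul]
    simp [this]
  have hs := (GaloisField.splits_zmod_X_pow_sub_X p).of_dvd
    (FiniteField.X_pow_card_sub_X_ne_zero (ZMod p) hp.one_lt) hdvd
  obtain ⟨c, hc⟩ := hs.exists_eval_eq_zero
    (minpoly.degree_pos (Algebra.IsIntegral.isIntegral f)).ne'
  exact ⟨c, Module.End.hasEigenvalue_of_isRoot hc⟩

theorem exists_ne_one_map_eq_pow_of_module {p : ℕ} [Fact p.Prime] {A : Type*} [CommGroup A]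
    [Finite A] [Nontrivial A] [Module (ZMod p) (Additive A)] (f : A →* A)
    (hf : ∀ a, f^[p - 1] a = a) : ∃ c : ℕ, ∃ a : A, a ≠ 1 ∧ f a = a ^ c := by
  let F : Module.End (ZMod p) (Additive A) := (MonoidHom.toAdditive f).toZModLinearMap p
  have hF : F ^ (p - 1) = 1 := by
    refine LinearMap.ext fun x => ?_
    rw [Module.End.pow_apply]
    have h : ∀ n : ℕ, F^[n] x = Additive.ofMul (f^[n] x.toMul) := by
      intro n
      induction n with
      | zero => rfl
      | succ n ih => rw [Function.iterate_succ_apply', ih, Function.iterate_succ_apply']; rfl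
    rw [h, hf, Module.End.one_apply, ofMul_toMul]
  obtain ⟨c, hc⟩ := exists_hasEigenvalue_of_pow_eq_one F hF
  obtain ⟨v, hv, hv0⟩ := hc.exists_hasEigenvector
  refine ⟨c.val, v.toMul, hv0, ?_⟩
  have h := Module.End.mem_eigenspace_iff.1 hv
  rw [← ZMod.natCast_zmod_val c, Nat.cast_smul_eq_nsmul] at h
  exact h

theorem exists_ne_one_map_eq_pow {p : ℕ} [Fact p.Prime] {A : Type*} [CommGroup A] [Finite A]
    [Nontrivial A] (hA : ∀ a : A, a ^ p = 1) (f : A →* A) (hf : ∀ a, f^[p - 1] a = a) :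
    ∃ c : ℕ, ∃ a : A, a ≠ 1 ∧ f a = a ^ c :=
  have : Module (ZMod p) (Additive A) := AddCommGroup.zmodModule fun x => hA x.toMul
  exists_ne_one_map_eq_pow_of_module f hf

/-! ### Cyclicity of a minimal normal `p`-subgroup read off from the action of `G`. -/

section Residual

variable {G : Type*} [Group G]

/-- The normal subgroup generated by all commutators and all `(p - 1)`-th powers. -/
def abelianExponentResidual (G : Type*) [Group G] (p : ℕ) : Subgroup G :=
  Subgroup.normalClosure ({x | ∃ g h : G, ⁅g, h⁆ = x} ∪ {x | ∃ g : G, g ^ (p - 1) = x})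

instance (p : ℕ) : (abelianExponentResidual G p).Normal := Subgroup.normalClosure_normal

theorem abelianExponentResidual_le {p : ℕ} {N : Subgroup G} [N.Normal]
    (h1 : ∀ g h : G, ⁅g, h⁆ ∈ N) (h2 : ∀ g : G, g ^ (p - 1) ∈ N) :
    abelianExponentResidual G p ≤ N := by
  refine Subgroup.normalClosure_le_normal ?_
  rintro _ (⟨g, h, rfl⟩ | ⟨g, rfl⟩)
  exacts [h1 g h, h2 g]

theorem commutator_mem_abelianExponentResidual (p : ℕ) (g h : G) :
    ⁅g, h⁆ ∈ abelianExponentResidual G p :=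
  Subgroup.subset_normalClosure (Or.inl ⟨g, h, rfl⟩)

theorem pow_mem_abelianExponentResidual (p : ℕ) (g : G) :
    g ^ (p - 1) ∈ abelianExponentResidual G p :=
  Subgroup.subset_normalClosure (Or.inr ⟨g, rfl⟩)

variable [Finite G] {p : ℕ} [Fact p.Prime] {V : Subgroup G}

/-- A minimal normal `p`-subgroup on which `G` acts as an abelian group of exponent dividing
`p - 1` is cyclic. -/
theorem IsMinimalNormal.isCyclic_of_centralizer (hV : IsMinimalNormal V) (hp : IsPGroup p V)
    (hcomm : ∀ g h : G, ⁅g, h⁆ ∈ Subgroup.centralizer (V : Set G))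
    (hpow : ∀ g : G, g ^ (p - 1) ∈ Subgroup.centralizer (V : Set G)) : IsCyclic V := by
  have := hV.normal
  have : Nontrivial V := (Subgroup.nontrivial_iff_ne_bot V).2 hV.ne_bot
  have hscalar : ∀ g : G, ∃ c : ℕ, ∀ v ∈ V, g * v * g⁻¹ = v ^ c := by
    intro g
    let _ : CommGroup V :=
      { (inferInstance : Group V) with
        mul_comm := fun a b => Subtype.ext (hV.mul_comm hp a.2 b.2) }
    let f : V →* V := (MulAut.conjNormal g : MulAut V).toMonoidHom
    have hfk : ∀ (k : ℕ) (a : V), ((f^[k] a : V) : G) = g ^ k * a * (g ^ k)⁻¹ := by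
      intro k
      induction k with
      | zero => intro a; simp
      | succ k ih =>
        intro a
        rw [Function.iterate_succ_apply', pow_succ']
        change ((MulAut.conjNormal g (f^[k] a) : V) : G) = _
        rw [MulAut.conjNormal_apply, ih]
        group
    obtain ⟨c, a, ha1, hac⟩ := exists_ne_one_map_eq_pow (p := p)
      (fun a : V => Subtype.ext (hV.pow_eq_one hp a.2)) f (fun a => by
        apply Subtype.ext
        rw [hfk, ← Subgroup.mem_centralizer_iff.1 (hpow g) a a.2, mul_inv_cancel_right])
    have hac' : g * (a : G) * g⁻¹ = (a : G) ^ c := congrArg Subtype.val hac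
    -- An eigenspace of `g` on `V`; it is `G`-invariant because `G` acts on `V` as an abelian group,
    -- so `g` acts as a scalar.
    let W : Subgroup G :=
      { carrier := {v | v ∈ V ∧ g * v * g⁻¹ = v ^ c}
        one_mem' := ⟨one_mem _, by simp⟩
        mul_mem' := by
          rintro x y ⟨hx, hx'⟩ ⟨hy, hy'⟩
          refine ⟨mul_mem hx hy, ?_⟩
          rw [Commute.mul_pow (hV.mul_comm hp hx hy), ← hx', ← hy']
          group
        inv_mem' := by
          rintro x ⟨hx, hx'⟩
          refine ⟨inv_mem hx, ?_⟩
          rw [inv_pow, ← hx']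
          group }
    have hWn : W.Normal := ⟨by
      rintro x ⟨hx, hx'⟩ h
      refine ⟨hV.normal.conj_mem x hx h, ?_⟩
      rw [conj_pow, ← hx']
      have hk := Subgroup.mem_centralizer_iff.1 (hcomm h⁻¹ g) x hx
      rw [commutatorElement_def, inv_inv] at hk
      calc g * (h * x * h⁻¹) * g⁻¹ = h * ((h⁻¹ * g * h * g⁻¹) * (g * x * g⁻¹) *
            (h⁻¹ * g * h * g⁻¹)⁻¹) * h⁻¹ := by group
        _ = h * (g * x * g⁻¹) * h⁻¹ := by
            rw [← Subgroup.mem_centralizer_iff.1 (by simpa [commutatorElement_def] using hcomm h⁻¹ g)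
              (g * x * g⁻¹) (hV.normal.conj_mem x hx g), mul_inv_cancel_right]⟩
    have hWV : W = V := by
      refine (hV.eq_bot_or_eq W hWn fun a ha => ha.1).resolve_left fun h => ha1 ?_
      have h1 : (a : G) ∈ W := ⟨a.2, hac'⟩
      rw [h, Subgroup.mem_bot] at h1
      exact Subtype.ext h1
    exact ⟨c, fun v hv => (hWV ▸ hv : v ∈ W).2⟩
  obtain ⟨⟨v, hv⟩, hv1⟩ := exists_ne (1 : V)
  have hn : (Subgroup.zpowers v).Normal := ⟨by
    intro x hx g
    obtain ⟨c, hc⟩ := hscalar g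
    rw [hc x (Subgroup.zpowers_le.2 hv hx)]
    exact pow_mem hx c⟩
  refine (Subgroup.isCyclic_iff_exists_zpowers_eq_top V).2 ⟨v, ?_⟩
  refine (hV.eq_bot_or_eq _ hn (Subgroup.zpowers_le.2 hv)).resolve_left fun h => hv1 ?_
  exact Subtype.ext (Subgroup.zpowers_eq_bot.1 h)

/-- The automorphism group of a group of order `p` is abelian of exponent dividing `p - 1`; here
this is computed on a generator `v`. -/
theorem IsMinimalNormal.residual_le_centralizer (hV : IsMinimalNormal V) (hp : IsPGroup p V)
    (hcyc : IsCyclic V) :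
    abelianExponentResidual G p ≤ Subgroup.centralizer (V : Set G) := by
  have := hV.normal
  obtain ⟨v, hv⟩ := (Subgroup.isCyclic_iff_exists_zpowers_eq_top V).1 hcyc
  have hvV : v ∈ V := hv ▸ Subgroup.mem_zpowers v
  have hvp := hV.pow_eq_one hp hvV
  have hconj : ∀ g : G, ∃ c : ℤ, g * v * g⁻¹ = v ^ c := fun g => by
    obtain ⟨c, hc⟩ := Subgroup.mem_zpowers_iff.1 (hv ▸ hV.normal.conj_mem v hvV g)
    exact ⟨c, hc.symm⟩
  have hmem : ∀ g : G, g * v * g⁻¹ = v → g ∈ Subgroup.centralizer (V : Set G) := by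
    intro g hg
    rw [Subgroup.mem_centralizer_iff]
    intro h hh
    obtain ⟨k, rfl⟩ := Subgroup.mem_zpowers_iff.1 (hv ▸ hh : h ∈ Subgroup.zpowers v)
    exact Commute.zpow_left (mul_inv_eq_iff_eq_mul.1 hg).symm k
  have hcpow : ∀ (g : G) (c k : ℤ), g * v * g⁻¹ = v ^ c → g * v ^ k * g⁻¹ = v ^ (c * k) := by
    intro g c k h
    rw [zpow_mul, ← h, conj_zpow]
  refine abelianExponentResidual_le (fun g h => hmem _ ?_) fun g => hmem _ ?_
  · obtain ⟨a, ha⟩ := hconj g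
    obtain ⟨b, hb⟩ := hconj h
    have h1 : g * h * v * (g * h)⁻¹ = h * g * v * (h * g)⁻¹ := by
      calc _ = g * (h * v * h⁻¹) * g⁻¹ := by group
        _ = h * (g * v * g⁻¹) * h⁻¹ := by rw [ha, hb, hcpow g a b ha, hcpow h b a hb, _root_.mul_comm]
        _ = _ := by group
    rw [commutatorElement_def]
    calc g * h * g⁻¹ * h⁻¹ * v * (g * h * g⁻¹ * h⁻¹)⁻¹
        = g * h * ((h * g)⁻¹ * v * (h * g)) * (g * h)⁻¹ := by group
      _ = v := by
        obtain ⟨c, hc⟩ := hconj (h * g)⁻¹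
        rw [inv_inv] at hc
        have h2 : g * h * v ^ c * (g * h)⁻¹ = h * g * v ^ c * (h * g)⁻¹ := by
          rw [← conj_zpow, ← conj_zpow, h1]
        rw [hc, h2, ← hc]
        group
  · obtain ⟨a, ha⟩ := hconj g
    have hk : ∀ k : ℕ, g ^ k * v * (g ^ k)⁻¹ = v ^ (a ^ k) := by
      intro k
      induction k with
      | zero => simp
      | succ k ih =>
        rw [pow_succ' a, ← hcpow g a _ ha, ← ih, pow_succ']
        group
    rw [hk]
    -- If `p` divides `a`, then `v` is trivial; otherwise Fermat's little theorem applies to `a`.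
    by_cases hpa : (a : ZMod p) = 0
    · obtain ⟨b, rfl⟩ := (ZMod.intCast_zmod_eq_zero_iff_dvd a p).1 hpa
      rw [zpow_mul, zpow_natCast, hvp, one_zpow] at ha
      have : v = 1 := by simpa using ha
      simp [this]
    · have h1 : ((a ^ (p - 1) : ℤ) : ZMod p) = ((1 : ℤ) : ZMod p) := by
        push_cast
        exact ZMod.pow_card_sub_one_eq_one hpa
      obtain ⟨b, hb⟩ := (ZMod.intCast_eq_intCast_iff_dvd_sub _ _ p).1 h1
      have : a ^ (p - 1) = 1 - p * b := by rw [← hb]; ring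
      rw [this, zpow_sub, zpow_mul, zpow_natCast, hvp, one_zpow, zpow_one, inv_one, mul_one]

/-- If a `p`-power of every element of the normal subgroup `E` centralises the minimal normal
`p`-subgroup `V`, then so does `E`. -/
theorem IsMinimalNormal.le_centralizer_of_forall_pow (hV : IsMinimalNormal V)
    (hp : IsPGroup p V) {E : Subgroup G} [E.Normal]
    (hE : ∀ e ∈ E, ∃ k : ℕ, e ^ p ^ k ∈ Subgroup.centralizer (V : Set G)) :
    E ≤ Subgroup.centralizer (V : Set G) := by
  have := hV.normal
  have : Nontrivial V := (Subgroup.nontrivial_iff_ne_bot V).2 hV.ne_bot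
  let S : Subgroup (MulAut V) := E.map (MulAut.conjNormal : G →* MulAut V)
  have hS : IsPGroup p S := by
    rintro ⟨_, e, he, rfl⟩
    obtain ⟨k, hk⟩ := hE e he
    refine ⟨k, Subtype.ext (MulEquiv.ext fun v => Subtype.ext ?_)⟩
    change ((((MulAut.conjNormal e : MulAut V) ^ p ^ k) v : V) : G) = v
    rw [← map_pow, MulAut.conjNormal_apply, ← Subgroup.mem_centralizer_iff.1 hk v v.2, mul_inv_cancel_right]
  obtain ⟨v, hv, hv1⟩ := hS.exists_fixed_point_of_prime_dvd_card_of_fixed_point V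
    (hp.card_eq_or_dvd.resolve_left Finite.one_lt_card.ne') (a := 1) (fun s => smul_one s)
  -- The fixed points of `E` in `V` form a normal subgroup of `G`, since `E` is normal; one
  -- nontrivial fixed point makes it all of `V`.
  have hvE : (v : G) ∈ V ⊓ Subgroup.centralizer (E : Set G) := by
    refine ⟨v.2, Subgroup.mem_centralizer_iff.2 fun e he => ?_⟩
    have h := congrArg Subtype.val (hv ⟨_, Subgroup.mem_map_of_mem _ he⟩)
    change ((MulAut.conjNormal e v : V) : G) = v at h
    rw [MulAut.conjNormal_apply] at h
    exact mul_inv_eq_iff_eq_mul.1 h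
  have h : V ⊓ Subgroup.centralizer (E : Set G) = V := by
    refine (hV.eq_bot_or_eq _ inferInstance inf_le_left).resolve_left fun h => hv1 ?_
    rw [h, Subgroup.mem_bot] at hvE
    exact (Subtype.ext hvE).symm
  exact Subgroup.le_centralizer_iff.1 (inf_eq_left.1 h)

end Residual

/-! ### Coprime action on hypercyclically embedded `p`-subgroups. -/

section CoprimeAction

variable {G : Type*} [Group G]

theorem residual_le_comap_centralizer [Finite G] {p : ℕ} [Fact p.Prime] {K L : Subgroup G}
    [L.Normal] (hp : IsPGroup p K) (h : IsChiefFactor K L) (hc : IsCyclicFactor K L) :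
    abelianExponentResidual G p ≤ (Subgroup.centralizer
      (K.map (QuotientGroup.mk' L) : Set (G ⧸ L))).comap (QuotientGroup.mk' L) := by
  have hV := h.isMinimalNormal
  have := hV.normal
  have hle := hV.residual_le_centralizer (hp.map _) hc
  refine abelianExponentResidual_le (fun g h => ?_) fun g => ?_
  · rw [Subgroup.mem_comap, map_commutatorElement]
    exact hle (commutator_mem_abelianExponentResidual p _ _)
  · rw [Subgroup.mem_comap, map_pow]
    exact hle (pow_mem_abelianExponentResidual p _)

theorem exists_isChiefFactor [Finite G] {N : Subgroup G} (hN : N.Normal) (h : N ≠ ⊥) :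
    ∃ M : Subgroup G, IsChiefFactor N M := by
  obtain ⟨M, hM⟩ := (Set.toFinite {M : Subgroup G | M.Normal ∧ M < N}).exists_maximal
    ⟨⊥, inferInstance, bot_lt_iff_ne_bot.2 h⟩
  refine ⟨M, hN, hM.1.1, hM.1.2, fun M' hM' hle hle' => ?_⟩
  rcases hle'.lt_or_eq with hlt | heq
  · exact Or.inl (le_antisymm (hM.2 ⟨hM', hlt⟩ hle) hle)
  · exact Or.inr heq

/-- If `g` has order prime to `p`, commutes with the `p`-element `r` and maps `x` to `x * r` under
conjugation, then `g` commutes with `x`. -/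
theorem commute_of_coprime {p : ℕ} {g x r : G} {j : ℕ} (hg : (orderOf g).Coprime p)
    (hx : g * x * g⁻¹ = x * r) (hr : g * r = r * g) (hrp : r ^ p ^ j = 1) : g * x = x * g := by
  have hk : ∀ k : ℕ, g ^ k * x * (g ^ k)⁻¹ = x * r ^ k := by
    intro k
    induction k with
    | zero => simp
    | succ k ih =>
      have h1 : g * r ^ k * g⁻¹ = r ^ k :=
        mul_inv_eq_iff_eq_mul.2 ((show Commute g r from hr).pow_right k)
      calc g ^ (k + 1) * x * (g ^ (k + 1))⁻¹ = g * (g ^ k * x * (g ^ k)⁻¹) * g⁻¹ := by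
            rw [pow_succ']; group
        _ = (g * x * g⁻¹) * (g * r ^ k * g⁻¹) := by rw [ih]; group
        _ = x * r ^ (k + 1) := by rw [hx, h1, pow_succ', mul_assoc]
  -- Conjugation by `g ^ orderOf g = 1` fixes `x`, so the order of `r` divides that of `g` as well
  -- as a power of `p`.
  have h1 : r ^ orderOf g = 1 := by
    have h := hk (orderOf g)
    rw [pow_orderOf_eq_one] at h
    simpa using h.symm
  have h2 : orderOf r = 1 := Nat.eq_one_of_dvd_coprimes (hg.pow_right j)
    (orderOf_dvd_of_pow_eq_one h1) (orderOf_dvd_of_pow_eq_one hrp)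
  rw [orderOf_eq_one_iff.1 h2, mul_one] at hx
  exact mul_inv_eq_iff_eq_mul.1 hx

/-- Climb a chief series of `R`: `g` centralises the cyclic factor `N / M` and, inductively, `M`;
having order prime to `p`, it centralises `N`. -/
theorem IsHypercyclicallyEmbedded.mem_centralizer [Finite G] {p : ℕ} [Fact p.Prime]
    {R : Subgroup G} (hR : IsHypercyclicallyEmbedded R) (hp : IsPGroup p R) {g : G}
    (hg : g ∈ abelianExponentResidual G p) (hgp : (orderOf g).Coprime p) :
    g ∈ Subgroup.centralizer (R : Set G) := by
  suffices ∀ N : Subgroup G, N.Normal → N ≤ R → g ∈ Subgroup.centralizer (N : Set G) from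
    this R hR.1 le_rfl
  intro N
  induction N using WellFoundedLT.induction with
  | ind N ih =>
    intro hN hNR
    by_cases hbot : N = ⊥
    · rw [hbot, Subgroup.mem_centralizer_iff]
      rintro h hh
      rw [Subgroup.mem_bot.1 hh, one_mul, mul_one]
    obtain ⟨M, hM⟩ := exists_isChiefFactor hN hbot
    have := hM.2.1
    have h1 := residual_le_comap_centralizer (hp.to_le hNR) hM (hR.2 N M hM hNR) hg
    rw [Subgroup.mem_comap, Subgroup.mem_centralizer_iff] at h1
    rw [Subgroup.mem_centralizer_iff]
    intro x hx
    have h2 : x⁻¹ * (g * x * g⁻¹) ∈ M := by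
      rw [← QuotientGroup.eq_one_iff]
      have := h1 _ (Subgroup.mem_map_of_mem _ hx)
      simp only [QuotientGroup.mk'_apply] at this
      simp only [QuotientGroup.mk_mul, QuotientGroup.mk_inv]
      rw [← this]
      group
    have h3 := ih M hM.2.2.1 hM.2.1 (hM.2.2.1.le.trans hNR)
    obtain ⟨j, hj⟩ := hp ⟨_, hNR (hM.2.2.1.le h2)⟩
    refine (commute_of_coprime hgp (r := x⁻¹ * (g * x * g⁻¹)) (j := j) (by group) ?_ ?_).symm
    · exact (Subgroup.mem_centralizer_iff.1 h3 _ h2).symm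
    · exact congrArg Subtype.val hj

theorem exists_pow_coprime [Finite G] {p : ℕ} (hp : p.Prime) (g : G) :
    ∃ k : ℕ, (orderOf (g ^ p ^ k)).Coprime p := by
  obtain ⟨k, m, hm, hk⟩ := Nat.exists_eq_pow_mul_and_not_dvd (orderOf_pos g).ne' p hp.ne_one
  refine ⟨k, ?_⟩
  rw [orderOf_pow_of_dvd (pow_ne_zero _ hp.ne_zero) (hk ▸ Dvd.intro _ rfl), hk,
    Nat.mul_div_cancel_left _ (pow_pos hp.pos k)]
  exact ((Nat.Prime.coprime_iff_not_dvd hp).2 hm).symm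

/-- The normal subgroup generated by the `p'`-elements of `abelianExponentResidual G p`. -/
def coprimeResidual (G : Type*) [Group G] (p : ℕ) : Subgroup G :=
  Subgroup.normalClosure {g | g ∈ abelianExponentResidual G p ∧ (orderOf g).Coprime p}

instance (p : ℕ) : (coprimeResidual G p).Normal := Subgroup.normalClosure_normal

theorem IsHypercyclicallyEmbedded.coprimeResidual_le_centralizer [Finite G] {p : ℕ}
    [Fact p.Prime] {R : Subgroup G} (hR : IsHypercyclicallyEmbedded R) (hp : IsPGroup p R) :
    coprimeResidual G p ≤ Subgroup.centralizer (R : Set G) := by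
  have := hR.1
  exact Subgroup.normalClosure_le_normal fun g hg => hR.mem_centralizer hp hg.1 hg.2

/-- Some `p`-power of each element of the residual is a `p'`-element, hence acts trivially on `P /
R`. So the residual acts as a `p`-group, and by irreducibility trivially. -/
theorem IsChiefFactor.isCyclicFactor_of_commutator_le [Finite G] {p : ℕ} [Fact p.Prime]
    {P R : Subgroup G} [R.Normal] (h : IsChiefFactor P R) (hp : IsPGroup p P)
    (hle : ⁅P, coprimeResidual G p⁆ ≤ R) : IsCyclicFactor P R := by
  have hV := h.isMinimalNormal
  have hVp : IsPGroup p (P.map (QuotientGroup.mk' R)) := hp.map _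
  have hE : ((abelianExponentResidual G p).map (QuotientGroup.mk' R)).Normal :=
    Subgroup.Normal.map inferInstance _ (QuotientGroup.mk'_surjective R)
  have hcent : (abelianExponentResidual G p).map (QuotientGroup.mk' R) ≤
      Subgroup.centralizer (P.map (QuotientGroup.mk' R) : Set (G ⧸ R)) := by
    refine hV.le_centralizer_of_forall_pow hVp ?_
    rintro _ ⟨e, he, rfl⟩
    obtain ⟨k, hk⟩ := exists_pow_coprime (Fact.out : p.Prime) e
    refine ⟨k, Subgroup.mem_centralizer_iff.2 ?_⟩
    rintro _ ⟨x, hx, rfl⟩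
    have h1 : ⁅x, e ^ p ^ k⁆ ∈ R := hle (Subgroup.commutator_mem_commutator hx
      (Subgroup.subset_normalClosure ⟨pow_mem he _, hk⟩))
    rw [← QuotientGroup.eq_one_iff] at h1
    rw [← map_pow]
    exact commutatorElement_eq_one_iff_mul_comm.1 h1
  refine hV.isCyclic_of_centralizer hVp ?_ ?_
  · intro g h
    obtain ⟨g, rfl⟩ := QuotientGroup.mk'_surjective R g
    obtain ⟨h, rfl⟩ := QuotientGroup.mk'_surjective R h
    rw [← map_commutatorElement]
    exact hcent (Subgroup.mem_map_of_mem _ (commutator_mem_abelianExponentResidual p g h))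
  · intro g
    obtain ⟨g, rfl⟩ := QuotientGroup.mk'_surjective R g
    rw [← map_pow]
    exact hcent (Subgroup.mem_map_of_mem _ (pow_mem_abelianExponentResidual p g))

end CoprimeAction

/-! ### Power maps in `p`-groups of class at most two. -/

section Exponent

variable {G : Type*} [Group G]

/-- Collecting the `a`'s to the left costs one factor `c` per crossing, `n.choose 2` in all. -/
theorem mul_pow_of_commute_commutator {a b c : G} (h : b * a = c * (a * b)) (ha : Commute c a)
    (hb : Commute c b) (n : ℕ) : (a * b) ^ n = c ^ (n.choose 2) * (a ^ n * b ^ n) := by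
  have hba : ∀ n : ℕ, b ^ n * a = c ^ n * (a * b ^ n) := by
    intro n
    induction n with
    | zero => simp
    | succ n ih =>
      calc b ^ (n + 1) * a = b * (b ^ n * a) := by rw [pow_succ', mul_assoc]
        _ = b * c ^ n * (a * b ^ n) := by rw [ih, mul_assoc]
        _ = c ^ n * (b * a) * b ^ n := by rw [← (hb.pow_left n).eq]; simp only [mul_assoc]
        _ = c ^ (n + 1) * (a * b ^ (n + 1)) := by rw [h, pow_succ, pow_succ']; simp only [mul_assoc]
  induction n with
  | zero => simp
  | succ n ih =>
    calc (a * b) ^ (n + 1) = c ^ (n.choose 2) * (a ^ n * (b ^ n * a)) * b := by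
          rw [pow_succ, ih]; simp only [mul_assoc]
      _ = c ^ (n.choose 2) * (a ^ n * c ^ n) * (a * b ^ n) * b := by
          rw [hba]; simp only [mul_assoc]
      _ = c ^ (n.choose 2) * c ^ n * (a ^ (n + 1) * b ^ (n + 1)) := by
          rw [← ((ha.pow_left n).pow_right n).eq, pow_succ a, pow_succ b]; simp only [mul_assoc]
      _ = _ := by rw [← pow_add, Nat.choose_succ_succ' n 1, Nat.choose_one_right, add_comm]

/-- If `P = [P, Q]` and the `m`-th power map on `P` is a homomorphism with values in the
centraliser of `Q`, then it is trivial. -/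
theorem pow_eq_one_of_commutator_eq {P Q : Subgroup G} [P.Normal] (hPQ : ⁅P, Q⁆ = P) {m : ℕ}
    (hmul : ∀ a ∈ P, ∀ b ∈ P, (a * b) ^ m = a ^ m * b ^ m)
    (hQ : ∀ a ∈ P, a ^ m ∈ Subgroup.centralizer (Q : Set G)) {x : G} (hx : x ∈ P) :
    x ^ m = 1 := by
  let W : Subgroup G :=
    { carrier := {x | x ∈ P ∧ x ^ m = 1}
      one_mem' := ⟨one_mem _, one_pow _⟩
      mul_mem' := by
        rintro a b ⟨ha, ha'⟩ ⟨hb, hb'⟩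
        exact ⟨mul_mem ha hb, by rw [hmul a ha b hb, ha', hb', one_mul]⟩
      inv_mem' := by
        rintro a ⟨ha, ha'⟩
        exact ⟨inv_mem ha, by rw [inv_pow, ha', inv_one]⟩ }
  have hW : ⁅P, Q⁆ ≤ W := by
    refine Subgroup.commutator_le.2 fun a ha q hq => ?_
    have h1 : q * a⁻¹ * q⁻¹ ∈ P := Subgroup.Normal.conj_mem inferInstance _ (inv_mem ha) q
    have h2 : ⁅a, q⁆ = a * (q * a⁻¹ * q⁻¹) := by rw [commutatorElement_def]; group
    refine ⟨h2 ▸ mul_mem ha h1, ?_⟩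
    -- The `m`-th power of `[a, q]` is `a ^ m` times the `q`-conjugate of its inverse, and `q`
    -- commutes with `a ^ m`.
    rw [h2, hmul a ha _ h1, conj_pow,
      Subgroup.mem_centralizer_iff.1 (hQ _ (inv_mem ha)) q hq, mul_inv_cancel_right, inv_pow,
      mul_inv_cancel]
  exact (hW (hPQ.symm ▸ hx : x ∈ ⁅P, Q⁆)).2

/-- Exponent of a `p`-group `P = [P, Q]` of class at most two whose commutators and `p`-th powers
lie in a central subgroup `R` centralised by `Q`. -/
theorem pow_eq_one_of_class_two {p : ℕ} (hp : p.Prime) {P Q R : Subgroup G} [P.Normal]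
    (hPQ : ⁅P, Q⁆ = P) (hRQ : R ≤ Subgroup.centralizer (Q : Set G))
    (hRP : R ≤ Subgroup.centralizer (P : Set G)) (hcomm : ∀ a ∈ P, ∀ b ∈ P, ⁅a, b⁆ ∈ R)
    (hpow : ∀ a ∈ P, a ^ p ∈ R) {x : G} (hx : x ∈ P) :
    x ^ p = 1 ∨ (x ^ 4 = 1 ∧ p = 2 ∧ ¬ IsMulCommutative P) := by
  have hc : ∀ r ∈ R, ∀ a ∈ P, Commute r a := fun r hr a ha =>
    (Subgroup.mem_centralizer_iff.1 (hRP hr) a ha).symm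
  have hformula : ∀ a ∈ P, ∀ b ∈ P, ∀ n : ℕ,
      (a * b) ^ n = ⁅b, a⁆ ^ (n.choose 2) * (a ^ n * b ^ n) := fun a ha b hb n =>
    mul_pow_of_commute_commutator (by rw [commutatorElement_def]; group)
      (hc _ (hcomm b hb a ha) a ha) (hc _ (hcomm b hb a ha) b hb) n
  have hcp : ∀ a ∈ P, ∀ b ∈ P, ⁅b, a⁆ ^ p = 1 := by
    intro a ha b hb
    have h1 : a * b * a⁻¹ = ⁅a, b⁆ * b := by rw [commutatorElement_def]; group
    -- Take `p`-th powers in `a b a⁻¹ = [a, b] b`: since `b ^ p` is central, the left side is `b ^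
    -- p`.
    have h2 : ⁅a, b⁆ ^ p = 1 := by
      have h3 := (hc _ (hcomm a ha b hb) b hb).mul_pow p
      rw [← h1, conj_pow, ← (hc _ (hpow b hb) a ha).eq, mul_inv_cancel_right] at h3
      exact mul_eq_right.1 h3.symm
    rw [← commutatorElement_inv, inv_pow, h2, inv_one]
  by_cases h2 : p = 2
  · subst h2
    by_cases hab : IsMulCommutative P
    · left
      refine pow_eq_one_of_commutator_eq hPQ (fun a ha b hb => ?_) (fun a ha => hRQ (hpow a ha)) hx
      have : a * b = b * a :=
        congrArg Subtype.val (hab.is_comm.comm (⟨a, ha⟩ : P) ⟨b, hb⟩)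
      exact (show Commute a b from this).mul_pow 2
    · right
      refine ⟨pow_eq_one_of_commutator_eq hPQ (fun a ha b hb => ?_) (fun a ha => hRQ ?_) hx, rfl,
        hab⟩
      -- Squaring need not be multiplicative, as `2.choose 2` is odd; fourth powers are, as
      -- `4.choose 2` is even.
      · rw [hformula a ha b hb, show Nat.choose 4 2 = 2 * 3 from rfl, pow_mul, hcp a ha b hb,
          one_pow, one_mul]
      · rw [show 4 = 2 * 2 from rfl, pow_mul]
        exact pow_mem (hpow a ha) 2
  · left
    refine pow_eq_one_of_commutator_eq hPQ (fun a ha b hb => ?_) (fun a ha => hRQ (hpow a ha)) hx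
    obtain ⟨k, hk⟩ := hp.dvd_choose_self two_ne_zero (lt_of_le_of_ne hp.two_le (Ne.symm h2))
    rw [hformula a ha b hb, hk, pow_mul, hcp a ha b hb, one_pow, one_mul]

end Exponent

/-! ### Supersoluble subgroups and generation by Hall subgroups. -/

section Supersoluble

variable {G : Type*} [Group G]

theorem IsCyclicFactor.mono {M K L : Subgroup G} [L.Normal] (h : IsCyclicFactor K L)
    (hMK : M ≤ K) : IsCyclicFactor M L := by
  have : IsCyclic (K.map (QuotientGroup.mk' L)) := h
  exact isCyclic_of_injective (Subgroup.inclusion (Subgroup.map_mono hMK))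
    (Subgroup.inclusion_injective _)

/-- At the first term of the series with `P ∩ N (i + 1)` outside `R`, this intersection is cyclic
modulo `P ∩ N i ≤ R`; a generator serves as `x`. -/
theorem exists_normal_zpowers_sup_of_isSupersoluble (hG : IsSupersoluble G) {P R : Subgroup G}
    [P.Normal] [R.Normal] (hPR : ¬ P ≤ R) :
    ∃ x ∈ P, x ∉ R ∧ (Subgroup.zpowers x ⊔ R).Normal := by
  obtain ⟨n, N, hN, h0, hn, hstep⟩ := hG
  obtain ⟨i, hi, hle, hnle⟩ : ∃ i < n, P ⊓ N i ≤ R ∧ ¬ P ⊓ N (i + 1) ≤ R := by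
    by_contra! hcon
    have : ∀ i ≤ n, P ⊓ N i ≤ R := by
      intro i
      induction i with
      | zero => intro _; simp [h0]
      | succ i ih => intro hi; exact hcon i hi (ih (Nat.le_of_succ_le hi))
    have h := this n le_rfl
    rw [hn, inf_top_eq] at h
    exact hPR h
  have := hN i
  have := hN (i + 1)
  obtain ⟨x, hx, hx'⟩ := isCyclicFactor_iff.1 ((hstep i hi).2.mono
    (inf_le_right : P ⊓ N (i + 1) ≤ N (i + 1)))
  have hle' : P ⊓ N (i + 1) ≤ Subgroup.zpowers x ⊔ R := by
    intro y hy
    obtain ⟨z, hz, r, hr, rfl⟩ := Subgroup.mem_sup_of_normal_right.1 (hx' hy)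
    have hzP : z ∈ P := Subgroup.zpowers_le.2 hx.1 hz
    refine mul_mem (Subgroup.mem_sup_left hz) (Subgroup.mem_sup_right (hle ⟨?_, hr⟩))
    simpa using mul_mem (inv_mem hzP) hy.1
  refine ⟨x, hx.1, fun hxR => hnle (hle'.trans (sup_le (Subgroup.zpowers_le.2 hxR) le_rfl)), ?_⟩
  have heq : Subgroup.zpowers x ⊔ R = (P ⊓ N (i + 1)) ⊔ R :=
    le_antisymm (sup_le_sup_right (Subgroup.zpowers_le.2 hx) R) (sup_le hle' le_sup_right)
  rw [heq]
  infer_instance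

theorem exists_conj_mem_zpowers_sup {K : Subgroup G} (hK : IsSupersoluble K) {P R : Subgroup G}
    (hP : P.Normal) (hR : R.Normal) (hPK : P ≤ K) (hPR : ¬ P ≤ R) :
    ∃ x ∈ P, x ∉ R ∧ ∀ k ∈ K, k * x * k⁻¹ ∈ Subgroup.zpowers x ⊔ R := by
  have h1 : ¬ P.subgroupOf K ≤ R.subgroupOf K := by
    intro h
    refine hPR fun x hx => ?_
    exact h (show (⟨x, hPK hx⟩ : K) ∈ P.subgroupOf K from hx)
  obtain ⟨x, hxP, hxR, hn⟩ := exists_normal_zpowers_sup_of_isSupersoluble hK h1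
  refine ⟨x, hxP, hxR, fun k hk => ?_⟩
  have h2 := hn.conj_mem x (Subgroup.mem_sup_left (Subgroup.mem_zpowers x)) ⟨k, hk⟩
  have h3 := Subgroup.mem_map_of_mem K.subtype h2
  rw [Subgroup.map_sup, MonoidHom.map_zpowers, Subgroup.subgroupOf_map_subtype] at h3
  exact (sup_le_sup le_rfl inf_le_left :
    _ ≤ Subgroup.zpowers (K.subtype x) ⊔ R) h3

/-- A prime dividing the index of `W` would divide the index of the Hall member for its own class.
-/
theorem le_of_forall_hall [Finite G] {σ : Set (Set Nat.Primes)} (hσ : Setoid.IsPartition σ)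
    {𝓗 : Set (Subgroup G)} (h𝓗 : IsCompleteHallSet σ 𝓗) {W : Subgroup G}
    (hW : ∀ s ∈ σ, ∀ D ∈ 𝓗, IsHall s D → D ≤ W) : W = ⊤ := by
  by_contra hne
  obtain ⟨q, hq, hqW⟩ := Nat.exists_prime_and_dvd (fun h => hne (Subgroup.index_eq_one.1 h))
  obtain ⟨s, ⟨hs, hqs⟩, -⟩ := hσ.2 ⟨q, hq⟩
  obtain ⟨D, ⟨hD, hDs⟩, -⟩ := h𝓗.2 s ⟨hs, ⟨q, hq⟩, hqs, hqW.trans W.index_dvd_card⟩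
  exact hDs.2 ⟨q, hq⟩ (hqW.trans (Subgroup.index_dvd_of_le (hW s hs D hD hDs))) hqs

end Supersoluble

/-! ### Modularity, permutability and `σ`-subnormality. -/

section Permutable

variable {G : Type*} [Group G]

/-- Modularity gives `A = ⟨A, D⟩ ∩ P`, which `D` normalises. -/
theorem IsModularSubgroup.conj_mem {A D P : Subgroup G} [P.Normal] (hA : IsModularSubgroup A)
    (hAP : A ≤ P) (hDP : D ⊓ P = ⊥) {a d : G} (ha : a ∈ A) (hd : d ∈ D) :
    d * a * d⁻¹ ∈ A := by
  have h := hA.2 D P hAP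
  rw [hDP, sup_bot_eq] at h
  rw [h]
  exact Subgroup.mem_inf.2 ⟨mul_mem (mul_mem (Subgroup.mem_sup_right hd) (Subgroup.mem_sup_left ha))
    (inv_mem (Subgroup.mem_sup_right hd)), Subgroup.Normal.conj_mem inferInstance a (hAP ha) d⟩

/-- The conjugate lies in `BD ∩ P`, and this is `B` because `B ≤ P` and `D ∩ P = 1`. -/
theorem IsHPermutable.conj_mem {𝓗 : Set (Subgroup G)} {B D P : Subgroup G} [P.Normal]
    (hB : IsHPermutable 𝓗 B) (hD : D ∈ 𝓗) (hBP : B ≤ P) (hDP : D ⊓ P = ⊥) {b d : G}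
    (hb : b ∈ B) (hd : d ∈ D) : d * b * d⁻¹ ∈ B := by
  have h : d * b ∈ (B : Set G) * (D : Set G) := hB D hD ▸ Set.mul_mem_mul hd hb
  obtain ⟨b', hb', d', hd', he⟩ := h
  have h1 : d * b * d⁻¹ ∈ P := Subgroup.Normal.conj_mem inferInstance b (hBP hb) d
  simp only at he
  rw [← he] at h1 ⊢
  have h2 : d' * d⁻¹ ∈ D ⊓ P := by
    refine Subgroup.mem_inf.2 ⟨mul_mem hd' (inv_mem hd), ?_⟩
    have := mul_mem (inv_mem (hBP hb')) h1
    simpa [mul_assoc] using this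
  rw [hDP, Subgroup.mem_bot] at h2
  rw [mul_assoc, h2, mul_one]
  exact hb'

theorem IsMHPermutable.conj_mem {𝓗 : Set (Subgroup G)} {S D P : Subgroup G} [P.Normal]
    (hS : IsMHPermutable 𝓗 S) (hD : D ∈ 𝓗) (hSP : S ≤ P) (hDP : D ⊓ P = ⊥) {x d : G}
    (hx : x ∈ S) (hd : d ∈ D) : d * x * d⁻¹ ∈ S := by
  obtain ⟨A, B, hA, hB, rfl⟩ := hS
  have hle : A ⊔ B ≤ (A ⊔ B).comap (MulAut.conj d).toMonoidHom := by
    refine sup_le (fun a ha => ?_) fun b hb => ?_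
    · exact Subgroup.mem_sup_left (hA.conj_mem (le_sup_left.trans hSP) hDP ha hd)
    · exact Subgroup.mem_sup_right (hB.conj_mem hD (le_sup_right.trans hSP) hDP hb hd)
  exact hle hx

theorem normal_or_isSigmaPrimary_of_eq_top {σ : Set (Set Nat.Primes)} {A U : Subgroup G}
    (hU : U = ⊤)
    (h : (A.subgroupOf U).Normal ∨ IsSigmaPrimary σ (U ⧸ (A.subgroupOf U).normalCore)) :
    A.Normal ∨ IsSigmaPrimary σ (G ⧸ A.normalCore) := by
  subst hU
  refine h.imp (fun h => ?_) fun h => ?_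
  · exact ⟨fun x hx g => h.conj_mem ⟨x, Subgroup.mem_top x⟩ hx ⟨g, Subgroup.mem_top g⟩⟩
  · have e : (⊤ : Subgroup G) ⧸ (A.subgroupOf ⊤).normalCore ≃* G ⧸ A.normalCore := by
      refine QuotientGroup.congr _ _ Subgroup.topEquiv ?_
      ext x
      constructor
      · rintro ⟨y, hy, rfl⟩ g
        exact hy ⟨g, Subgroup.mem_top g⟩
      · intro hx
        exact ⟨⟨x, Subgroup.mem_top x⟩, fun g => hx g, rfl⟩
    rintro s ⟨hs, q, hq, hqd⟩ t ⟨ht, r, hr, hrd⟩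
    rw [← Nat.card_congr e.toEquiv] at hqd hrd
    exact h ⟨hs, q, hq, hqd⟩ ⟨ht, r, hr, hrd⟩

theorem IsSigmaSubnormal.exists_last {σ : Set (Set Nat.Primes)} {T : Subgroup G}
    (hT : IsSigmaSubnormal σ T) (hne : T ≠ ⊤) :
    ∃ M : Subgroup G, T ≤ M ∧ M ≠ ⊤ ∧
      (M.Normal ∨ IsSigmaPrimary σ (G ⧸ M.normalCore)) := by
  obtain ⟨n, C, h0, hn, hstep⟩ := hT
  have hmono : ∀ i ≤ n, T ≤ C i := by
    intro i
    induction i with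
    | zero => intro _; rw [h0]
    | succ i ih => intro hi; exact (ih (Nat.le_of_succ_le hi)).trans (hstep i hi).1
  obtain ⟨i, hi, hne', htop⟩ : ∃ i < n, C i ≠ ⊤ ∧ C (i + 1) = ⊤ := by
    by_contra! hcon
    have : ∀ i ≤ n, C i ≠ ⊤ := by
      intro i
      induction i with
      | zero => intro _; rwa [h0]
      | succ i ih => intro hi; exact hcon i hi (ih (Nat.le_of_succ_le hi))
    exact this n le_rfl hn
  exact ⟨C i, hmono i hi.le, hne', normal_or_isSigmaPrimary_of_eq_top htop (hstep i hi).2⟩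

theorem le_of_coprime_card_quotient [Finite G] {D N : Subgroup G} [N.Normal]
    (h : (Nat.card D).Coprime (Nat.card (G ⧸ N))) : D ≤ N := by
  intro d hd
  rw [← QuotientGroup.eq_one_iff, ← orderOf_eq_one_iff]
  refine Nat.eq_one_of_dvd_coprimes h ?_ (orderOf_dvd_natCard _)
  exact (orderOf_map_dvd (QuotientGroup.mk' N) d).trans (Subgroup.orderOf_dvd_natCard D hd)

/-- A weakly `m`-`𝓗`-permutable `p`-subgroup `H` is `m`-`𝓗`-permutable, or some normal subgroup
`N` not containing `H` contains every Hall `s`-subgroup with `p ∉ s`. -/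
theorem IsWeaklyMHPermutable.isMHPermutable_or [Finite G] {σ : Set (Set Nat.Primes)}
    (hσ : Setoid.IsPartition σ) {𝓗 : Set (Subgroup G)} {H : Subgroup G} (p : Nat.Primes)
    (hp : IsPGroup p H) (hH : IsWeaklyMHPermutable σ 𝓗 H) :
    IsMHPermutable 𝓗 H ∨ ∃ N : Subgroup G, N.Normal ∧ ¬ H ≤ N ∧
      ∀ s ∈ σ, p ∉ s → ∀ D : Subgroup G, IsHall s D → D ≤ N := by
  have : Fact (p : ℕ).Prime := ⟨p.2⟩
  obtain ⟨T, hT, hHT, S, hS, hle, hle'⟩ := hH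
  by_cases htop : T = ⊤
  · left
    rw [htop, inf_top_eq] at hle
    rwa [le_antisymm hle hle']
  right
  obtain ⟨M, hTM, hM, hM'⟩ := hT.exists_last htop
  have hgen : ∀ g : G, ∃ h ∈ H, ∃ t ∈ T, h * t = g := fun g =>
    Set.mem_mul.1 (hHT ▸ Set.mem_univ g : g ∈ (H : Set G) * (T : Set G))
  have hHM : ¬ H ≤ M := by
    intro h
    refine hM (eq_top_iff.2 fun g _ => ?_)
    obtain ⟨h', hh', t, ht, rfl⟩ := hgen g
    exact mul_mem (h hh') (hTM ht)
  rcases hM' with hn | hprim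
  -- Since `G = HM`, the quotient `G / M` is an image of the `p`-group `H`.
  · refine ⟨M, hn, hHM, fun s hs hps D hD => le_of_coprime_card_quotient ?_⟩
    have hq : IsPGroup p (G ⧸ M) := by
      refine hp.of_surjective ((QuotientGroup.mk' M).comp H.subtype) fun y => ?_
      obtain ⟨g, rfl⟩ := QuotientGroup.mk'_surjective M y
      obtain ⟨h', hh', t, ht, rfl⟩ := hgen g
      refine ⟨⟨h', hh'⟩, ?_⟩
      have := (QuotientGroup.eq_one_iff (N := M) t).2 (hTM ht)
      simp [this]
    obtain ⟨k, hk⟩ := IsPGroup.iff_card.1 hq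
    rw [hk]
    refine Nat.Coprime.pow_right k ((Nat.Prime.coprime_iff_not_dvd p.2).2 fun h => ?_).symm
    exact hps (hD.1 p h)
  · have hHM' : ¬ H ≤ M.normalCore := fun h => hHM (h.trans M.normalCore_le)
    refine ⟨M.normalCore, inferInstance, hHM', fun s hs hps D hD =>
      le_of_coprime_card_quotient (Nat.Coprime.symm ?_)⟩
    -- As `H` has nontrivial image here, the single class of the `σ`-primary quotient is the one
    -- containing `p`.
    have hpd : (p : ℕ) ∣ Nat.card (G ⧸ M.normalCore) := by
      have h1 : IsPGroup p (H.map (QuotientGroup.mk' M.normalCore)) := hp.map _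
      refine (h1.card_eq_or_dvd.resolve_left fun h => hHM' ?_).trans (Subgroup.card_subgroup_dvd_card _)
      rw [Subgroup.card_eq_one, Subgroup.map_eq_bot_iff, QuotientGroup.ker_mk'] at h
      exact h
    refine Nat.Coprime.symm (Nat.coprime_of_dvd fun q hq hqD hqM => ?_)
    have hqs := hD.1 ⟨q, hq⟩ hqD
    obtain ⟨t, ⟨ht, hpt⟩, -⟩ := hσ.2 p
    exact hps (hprim ⟨hs, ⟨q, hq⟩, hqs, hqM⟩ ⟨ht, p, hpt, hpd⟩ ▸ hpt)

end Permutable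

/-! ### The minimal counterexample. -/

variable {G : Type*} [Group G]

theorem mem_normalizer_zpowers_sup [Finite G] {R : Subgroup G} [R.Normal] {x g : G}
    (h : g * x * g⁻¹ ∈ Subgroup.zpowers x ⊔ R) :
    g ∈ Subgroup.normalizer ((Subgroup.zpowers x ⊔ R : Subgroup G) : Set G) := by
  refine Subgroup.mem_normalizer_fintype fun n hn => ?_
  have hle : Subgroup.zpowers x ⊔ R ≤
      (Subgroup.zpowers x ⊔ R).comap (MulAut.conj g).toMonoidHom :=
    sup_le (Subgroup.zpowers_le.2 h) fun r hr =>
      Subgroup.mem_sup_right (Subgroup.Normal.conj_mem inferInstance r hr g)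
  exact hle hn

theorem conj_mem_zpowers_sup_of_commutator_mem {R : Subgroup G} {x g : G} (h : ⁅g, x⁆ ∈ R) :
    g * x * g⁻¹ ∈ Subgroup.zpowers x ⊔ R := by
  have : g * x * g⁻¹ = ⁅g, x⁆ * x := by rw [commutatorElement_def]; group
  rw [this]
  exact mul_mem (Subgroup.mem_sup_right h) (Subgroup.mem_sup_left (Subgroup.mem_zpowers x))

/-- If `R` contains every proper subgroup of `P` that is normal in `G` and `P` has an element of
the hypercentre outside `R`, then `G` centralises `P / R`. -/
theorem commutator_mem_of_mem_hypercentre {P R : Subgroup G} [P.Normal]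
    (hmax : ∀ N : Subgroup G, N.Normal → N ≤ P → N ≠ P → N ≤ R) {x : G} (hx : x ∈ P)
    (hxR : x ∉ R) (hxZ : x ∈ hypercentre G) {y : G} (hy : y ∈ P) (g : G) : ⁅g, y⁆ ∈ R := by
  obtain ⟨n, hn⟩ := (Subgroup.mem_iSup_of_directed
    (Subgroup.upperCentralSeries_mono G).directed_le).1 hxZ
  induction n with
  | zero =>
    rw [Subgroup.upperCentralSeries_zero, Subgroup.mem_bot] at hn
    exact absurd (hn ▸ one_mem R) hxR
  | succ n ih =>
    have hP : P ⊓ Subgroup.upperCentralSeries G (n + 1) = P := by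
      by_contra h
      exact hxR (hmax _ inferInstance inf_le_left h ⟨hx, hn⟩)
    have hmem : ∀ z ∈ P, ⁅g, z⁆ ∈ P ⊓ Subgroup.upperCentralSeries G n := by
      intro z hz
      refine Subgroup.mem_inf.2 ⟨?_, ?_⟩
      · rw [commutatorElement_def]
        exact mul_mem (Subgroup.Normal.conj_mem inferInstance z hz g) (inv_mem hz)
      · rw [← commutatorElement_inv]
        exact inv_mem (Subgroup.mem_upperCentralSeries_succ_iff.1 (inf_eq_left.1 hP hz) g)
    -- All of `[g, P]` lies in `P ∩ Z_n`: either this is `P` and `n` can be lowered, or it is proper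
    -- and so inside `R`.
    by_cases h : P ⊓ Subgroup.upperCentralSeries G n = P
    · exact ih (inf_eq_left.1 h hx)
    · exact hmax _ inferInstance inf_le_left h (hmem y hy)

/-- If `H ≤ P` is weakly `m`-`𝓗`-permutable, then a Hall subgroup `D` from `𝓗` whose order is
prime to that of `P` normalises `H` or centralises `P / R`. -/
theorem IsWeaklyMHPermutable.conj_mem [Finite G] {σ : Set (Set Nat.Primes)}
    (hσ : Setoid.IsPartition σ) {𝓗 : Set (Subgroup G)} (p : Nat.Primes) {P R : Subgroup G}
    [P.Normal] [R.Normal] (hPp : IsPGroup p P)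
    (hmax : ∀ N : Subgroup G, N.Normal → N ≤ P → N ≠ P → N ≤ R) {x : G} (hx : x ∈ P)
    (hperm : IsWeaklyMHPermutable σ 𝓗 (Subgroup.zpowers x)) {s : Set Nat.Primes} (hs : s ∈ σ)
    (hps : p ∉ s) {D : Subgroup G} (hD : D ∈ 𝓗) (hDs : IsHall s D) {d : G} (hd : d ∈ D) :
    d * x * d⁻¹ ∈ Subgroup.zpowers x ⊔ R := by
  have : Fact (p : ℕ).Prime := ⟨p.2⟩
  have hle : Subgroup.zpowers x ≤ P := Subgroup.zpowers_le.2 hx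
  rcases hperm.isMHPermutable_or hσ p (hPp.to_le hle) with h | ⟨N, hN, hnle, hDN⟩
  · have hDP : D ⊓ P = ⊥ := by
      have h1 : IsPGroup p (D ⊓ P : Subgroup G) := hPp.to_le inf_le_right
      rw [← Subgroup.card_eq_one]
      refine h1.card_eq_or_dvd.resolve_right fun h => hps (hDs.1 p ?_)
      exact h.trans (Subgroup.card_dvd_of_le inf_le_left)
    exact Subgroup.mem_sup_left (h.conj_mem hD hle hDP (Subgroup.mem_zpowers x) hd)
  · refine conj_mem_zpowers_sup_of_commutator_mem ?_
    -- `D ≤ N` gives `[D, P] ≤ P ∩ N`, a proper subgroup of `P` normal in `G`, hence inside `R`.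
    have hne : P ⊓ N ≠ P := fun h => hnle (hle.trans (inf_eq_left.1 h))
    refine hmax _ inferInstance inf_le_left hne (Subgroup.mem_inf.2 ⟨?_, ?_⟩)
    · rw [commutatorElement_def]
      exact mul_mem (Subgroup.Normal.conj_mem inferInstance x hx d) (inv_mem hx)
    · have hd' := hDN s hs hps D hDs hd
      have h1 : ⁅d, x⁆ = d * (x * d⁻¹ * x⁻¹) := by rw [commutatorElement_def]; group
      rw [h1]
      exact mul_mem hd' (hN.conj_mem _ (inv_mem hd') x)

/-- If `P / R` is a noncyclic chief factor, `R` is hypercyclically embedded in `G` and contains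
every proper subgroup of `P` that is normal in `G`, then `P` has small exponent. -/
theorem IsChiefFactor.pow_eq_one [Finite G] {p : ℕ} [hp : Fact p.Prime] {P R : Subgroup G}
    [R.Normal] (hchief : IsChiefFactor P R) (hPp : IsPGroup p P)
    (hR : IsHypercyclicallyEmbedded R) (hncyc : ¬ IsCyclicFactor P R)
    (hmax : ∀ N : Subgroup G, N.Normal → N ≤ P → N ≠ P → N ≤ R) {x : G} (hx : x ∈ P) :
    x ^ p = 1 ∨ (x ^ 4 = 1 ∧ p = 2 ∧ ¬ IsMulCommutative P) := by
  have := hchief.1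
  have hRP : R ≤ P := hchief.2.2.1.le
  have hPQ : ⁅P, coprimeResidual G p⁆ = P := by
    by_contra h
    exact hncyc (hchief.isCyclicFactor_of_commutator_le hPp
      (hmax _ inferInstance (Subgroup.commutator_le_left _ _) h))
  have hRQ : R ≤ Subgroup.centralizer (coprimeResidual G p : Set G) :=
    Subgroup.le_centralizer_iff.1 (hR.coprimeResidual_le_centralizer (hPp.to_le hRP))
  have hRQ' : ⁅R, coprimeResidual G p⁆ = ⊥ := Subgroup.commutator_eq_bot_iff_le_centralizer.2 hRQ
  -- Three subgroups lemma; together with `hPQ` it makes `R` central in `P`.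
  have hPR : ⁅⁅P, coprimeResidual G p⁆, R⁆ = ⊥ := by
    refine Subgroup.commutator_commutator_eq_bot_of_rotate ?_ ?_
    · rw [Subgroup.commutator_comm (coprimeResidual G p) R, hRQ', Subgroup.commutator_bot_left]
    · exact le_bot_iff.1 (hRQ' ▸ Subgroup.commutator_mono (Subgroup.commutator_le_left R P) le_rfl)
  rw [hPQ, Subgroup.commutator_comm, Subgroup.commutator_eq_bot_iff_le_centralizer] at hPR
  have hV := hchief.isMinimalNormal
  have hVp : IsPGroup p (P.map (QuotientGroup.mk' R)) := hPp.map _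
  refine pow_eq_one_of_class_two hp.out hPQ hRQ hPR (fun a ha b hb => ?_) (fun a ha => ?_) hx
  · rw [← QuotientGroup.eq_one_iff]
    exact commutatorElement_eq_one_iff_mul_comm.2 (hV.mul_comm hVp
      (Subgroup.mem_map_of_mem (QuotientGroup.mk' R) ha)
      (Subgroup.mem_map_of_mem (QuotientGroup.mk' R) hb))
  · rw [← QuotientGroup.eq_one_iff]
    exact hV.pow_eq_one hVp (Subgroup.mem_map_of_mem (QuotientGroup.mk' R) ha)

/-- Divisibility by `p` makes `K` nontrivial and fixes its class, and a class has only one Hall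
member. -/
theorem IsCompleteHallSet.eq_of_isHall [Finite G] {σ : Set (Set Nat.Primes)}
    (hσ : Setoid.IsPartition σ) {𝓗 : Set (Subgroup G)} (h𝓗 : IsCompleteHallSet σ 𝓗)
    {p : Nat.Primes} {K D : Subgroup G} (hK : K ∈ 𝓗) (hpK : (p : ℕ) ∣ Nat.card K)
    (hD : D ∈ 𝓗) {s : Set Nat.Primes} (hs : s ∈ σ) (hps : p ∈ s) (hDs : IsHall s D) : D = K := by
  have hne : K ≠ ⊥ := by
    rintro rfl
    rw [Subgroup.card_bot] at hpK
    exact p.2.one_lt.ne' (Nat.dvd_one.1 hpK)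
  obtain ⟨t, ht, hKt⟩ := h𝓗.1 K hK hne
  obtain rfl : s = t := (hσ.2 p).unique ⟨hs, hps⟩ ⟨ht, hKt.1 p hpK⟩
  exact (h𝓗.2 s ⟨hs, p, hps, hpK.trans (Subgroup.card_subgroup_dvd_card K)⟩).unique
    ⟨hD, hDs⟩ ⟨hK, hKt⟩

theorem orderOf_prime_or_eq_four {p : ℕ} (hp : p.Prime) {x : G} (hx1 : x ≠ 1) {c : Prop}
    (h : x ^ p = 1 ∨ (x ^ 4 = 1 ∧ p = 2 ∧ c)) :
    (orderOf x).Prime ∨ (orderOf x = 4 ∧ p = 2 ∧ c) := by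
  rcases h with h | ⟨h, hc⟩
  · have := Fact.mk hp
    exact Or.inl (orderOf_eq_prime h hx1 ▸ hp)
  · have hd : orderOf x ∣ 2 ^ 2 := orderOf_dvd_of_pow_eq_one h
    obtain ⟨k, hk, hxk⟩ := (Nat.dvd_prime_pow Nat.prime_two).1 hd
    interval_cases k
    · exact absurd (orderOf_eq_one_iff.1 hxk) hx1
    · exact Or.inl (hxk ▸ Nat.prime_two)
    · exact Or.inr ⟨hxk, hc⟩

theorem isHypercyclicallyEmbedded_of_isWeaklyMHPermutable [Finite G]
    {σ : Set (Set Nat.Primes)} (hσ : Setoid.IsPartition σ) {𝓗 : Set (Subgroup G)}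
    (h𝓗 : IsCompleteHallSet σ 𝓗) (p : Nat.Primes) {K : Subgroup G} (hK : K ∈ 𝓗)
    (hKs : IsSupersoluble K) (P : Subgroup G) (hPn : P.Normal) (hPp : IsPGroup p P) (hPK : P ≤ K)
    (hperm : ∀ H : Subgroup G, H ≤ P → IsCyclic H →
      ((Nat.card H).Prime ∨ (Nat.card H = 4 ∧ (p : ℕ) = 2 ∧ ¬ IsMulCommutative P)) →
      ¬ H ≤ hypercentre G → IsWeaklyMHPermutable σ 𝓗 H) :
    IsHypercyclicallyEmbedded P := by
  have : Fact (p : ℕ).Prime := ⟨p.2⟩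
  induction P using WellFoundedLT.induction with
  | ind P ih =>
  have ih' : ∀ N : Subgroup G, N.Normal → N < P → IsHypercyclicallyEmbedded N := by
    intro N hN hlt
    -- The order-four clause is inherited because a group with a nonabelian subgroup is nonabelian.
    refine ih N hlt hN (hPp.to_le hlt.le) (hlt.le.trans hPK) fun H hH hc ho hZ =>
      hperm H (hH.trans hlt.le) hc (ho.imp_right fun h => ⟨h.1, h.2.1, fun hab => h.2.2 ?_⟩) hZ
    refine ⟨⟨fun a b => Subtype.ext ?_⟩⟩
    have hab' := hab.is_comm.comm (⟨a, hlt.le a.2⟩ : P) ⟨b, hlt.le b.2⟩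
    exact (Subtype.ext_iff.1 hab' : (a : G) * b = b * a)
  refine ⟨hPn, fun M R hRn hchief hle => ?_⟩
  rcases hle.lt_or_eq with hlt | rfl
  · exact (ih' M hchief.1 hlt).2 M R hchief le_rfl
  by_contra hncyc
  have hRM : R < M := hchief.2.2.1
  have hmax : ∀ N : Subgroup G, N.Normal → N ≤ M → N ≠ M → N ≤ R := by
    intro N hN hNM hne
    by_contra hNR
    have hsup : N ⊔ R = M :=
      (hchief.2.2.2 (N ⊔ R) inferInstance le_sup_right (sup_le hNM hRM.le)).resolve_left
        fun h => hNR (sup_eq_right.1 h)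
    exact hncyc (isCyclicFactor_of_sup_eq hN hsup hchief (ih' N hN (hNM.lt_of_ne hne)))
  have hexp := fun {x : G} => hchief.pow_eq_one hPp (ih' R hRn hRM) hncyc hmax (x := x)
  obtain ⟨x, hxM, hxR, hxK⟩ := exists_conj_mem_zpowers_sup hKs hPn hRn hPK hRM.not_ge
  have hx1 : x ≠ 1 := fun h => hxR (h ▸ one_mem R)
  have hzM : Subgroup.zpowers x ≤ M := Subgroup.zpowers_le.2 hxM
  have hpK : (p : ℕ) ∣ Nat.card K := by
    refine (hPp.card_eq_or_dvd.resolve_left fun h => ?_).trans (Subgroup.card_dvd_of_le hPK)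
    rw [Subgroup.card_eq_one] at h
    exact (bot_le.trans_lt hRM).ne' h
  have hnorm : Subgroup.normalizer ((Subgroup.zpowers x ⊔ R : Subgroup G) : Set G) = ⊤ := by
    refine le_of_forall_hall hσ h𝓗 fun s hs D hD hDs d hd => mem_normalizer_zpowers_sup ?_
    -- In the class of `p` the member is `K` itself, handled by the choice of `x`.
    by_cases hps : p ∈ s
    · exact hxK d (h𝓗.eq_of_isHall hσ hK hpK hD hs hps hDs ▸ hd)
    by_cases hZ : Subgroup.zpowers x ≤ hypercentre G
    · exact conj_mem_zpowers_sup_of_commutator_mem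
        (commutator_mem_of_mem_hypercentre hmax hxM hxR (Subgroup.zpowers_le.1 hZ) hxM d)
    · refine IsWeaklyMHPermutable.conj_mem hσ p hPp hmax hxM
        (hperm _ hzM inferInstance ?_ hZ) hs hps hD hDs hd
      rw [Nat.card_zpowers]
      exact orderOf_prime_or_eq_four p.2 hx1 (hexp hxM)
  have hU : Subgroup.zpowers x ⊔ R = M := by
    refine (hchief.2.2.2 _ (Subgroup.normalizer_eq_top_iff.1 hnorm) le_sup_right
      (sup_le hzM hRM.le)).resolve_left fun h => hxR ?_
    exact h ▸ Subgroup.mem_sup_left (Subgroup.mem_zpowers x)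
  exact hncyc (isCyclicFactor_iff.2 ⟨x, hxM, hU.ge⟩)

end SigmaGroup

theorem mainTheorem3 {G : Type*} [Group G] [Finite G]
    (σ : Set (Set Nat.Primes)) (hσ : Setoid.IsPartition σ)
    (hG : SigmaGroup.IsSigmaFullSylowType σ G)
    (𝓗 : Set (Subgroup G)) (h𝓗 : SigmaGroup.IsCompleteHallSet σ 𝓗)
    (hsuper : ∀ H ∈ 𝓗, SigmaGroup.IsSupersoluble H)
    (p : ℕ) (hp : p.Prime)
    (P : Subgroup G) (hPnormal : P.Normal) (hPp : IsPGroup p P)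
    (hP𝓗 : ∃ K ∈ 𝓗, P ≤ K)
    (hperm : ∀ H : Subgroup G, H ≤ P → IsCyclic H →
      ((Nat.card H).Prime ∨ (Nat.card H = 4 ∧ p = 2 ∧ ¬ IsMulCommutative P)) →
      ¬ H ≤ SigmaGroup.hypercentre G →
      SigmaGroup.IsWeaklyMHPermutable σ 𝓗 H) :
    SigmaGroup.IsHypercyclicallyEmbedded P := by
  obtain ⟨K, hK, hPK⟩ := hP𝓗
  exact SigmaGroup.isHypercyclicallyEmbedded_of_isWeaklyMHPermutable hσ h𝓗 ⟨p, hp⟩ hK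
    (hsuper K hK) P hPnormal hPp hPK hperm
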